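/- **Conventions.** A directed set is a nonempty partially ordered set in which any two elements have an upper bound; a subset is bounded if it has an upper bound. $P\ge_T Q$ means that some map $P\to Q$ carries cofinal sets to cofinal sets, and $P=_TQ$ means $P\ge_TQ$ and $Q\ge_TP$. $P$ has calibre $(\kappa,\lambda)$ if every $\kappa$-sized subset contains a bounded $\lambda$-sized subset; calibre $(\kappa,\lambda,\mu)$ if every $\kappa$-sized subset contains a $\lambda$-sized subset $S$ all of whose $\mu$-sized subsets are bounded; calibre $(\kappa,\lambda,\mu,\nu)$ if every $\kappa$-sized subset contains a $\lambda$-sized subset $S$ such that every $\mu$-sized subset of $S$ contains a bounded $\nu$-sized subset. A set $P'\subseteq P$ has relative calibre $\omega$ in $P$ if every countably infinite subset of $P'$ contains an infinite subset bounded in $P$. $P$ is of type $(\omega^\omega,\text{relative calibre }\omega)$ if $P=\bigcup\{P_f: f\in\omega^\omega\}$ where $P_f\subseteq P_g$ whenever $f\le g$ pointwise and each $P_f$ has relative calibre $\omega$ in $P$. $P$ is powerfully calibre $(\omega_1,\omega)$ if $P^\omega$ (product order) has calibre $(\omega_1,\omega)$, and productively calibre $(\omega_1,\omega)$ if $P\times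 Q$ has calibre $(\omega_1,\omega)$ for every directed set $Q$ with calibre $(\omega_1,\omega)$. A directed set with a topology is CSB (respectively CSBS) if every convergent sequence is bounded (respectively has a bounded subsequence). $\mathfrak b$ is the least size of a subset of $\omega^\omega$ unbounded in the mod-finite order, and $\mathfrak c=2^{\aleph_0}$. $[\mathfrak c]^{<\omega}$ is the set of finite subsets of $\mathfrak c$, ordered by inclusion. For a topological space $X$, $\mathcal K(X)$ is the set of compact subsets of $X$ ordered by inclusion, with the Vietoris topology. The Cantor–Bendixson height of a compact $K\subseteq 2^\omega$ is the least ordinal $\gamma$ such that the Cantor–Bendixson derivative of $K$ of order $\gamma+1$ is empty, if there is one (so nonempty finite sets have height $0$, and uncountable compact sets have no height). **Statement.** Let $\alpha>0$ be a countable ordinal and let $\mathcal K^{(\alpha)}$ be the subspace of $\mathcal K(2^\omega)$ consisting of the (necessarily countable) compact sets of Cantor–Bendixson height $<\alpha$, ordered by inclusion. If $\alpha$ is a successor, then $\mathcal K^{(\alpha)}=_T[\mathfrak c]^{<\omega}$. If $\alpha=\lambda$ is a limit, then: (a) $\mathcal K^{(\lambda)}$ is second countable but is not CSBS, does not have calibre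 $(\omega_1,\omega_1,\omega)$, and there is no separable metrizable space $M$ with $\mathcal K(M)\ge_T\mathcal K^{(\lambda)}$; (b) some topology on $\mathcal K^{(\lambda)}$ finer than the given one is second countable and CSB; (c) $\mathcal K^{(\lambda)}$ is of type $(\omega^\omega,\text{relative calibre }\omega)$; (d) $\mathcal K^{(\lambda)}$ is powerfully calibre $(\omega_1,\omega)$; (e) if $\omega_1<\mathfrak b$, then $\mathcal K^{(\lambda)}$ has calibre $(\omega_1,\omega_1,\omega,\omega)$ and is productively calibre $(\omega_1,\omega)$. -/

import Mathlib

open Cardinal Set Filter Topology TopologicalSpace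

universe u v

/-! ### Tukey quotients -/

/-- `P ≥_T Q`: some map `P → Q` carries cofinal sets to cofinal sets. -/
def TukeyGE (P : Type*) (Q : Type*) [LE P] [LE Q] : Prop :=
  ∃ φ : P → Q, ∀ C : Set P, IsCofinal C → IsCofinal (φ '' C)

/-- Tukey equivalence `P =_T Q`. -/
def TukeyEquiv (P : Type*) (Q : Type*) [LE P] [LE Q] : Prop :=
  TukeyGE P Q ∧ TukeyGE Q P

/-! ### Calibres

"Bounded" means having an upper bound in `P`. -/

/-- Calibre `(κ, lam)`: every `κ`-sized subset contains a bounded `lam`-sized subset. -/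
def Calibre₂ (κ lam : Cardinal.{u}) (P : Type u) [LE P] : Prop :=
  ∀ A : Set P, #A = κ → ∃ S ⊆ A, #S = lam ∧ BddAbove S

/-- Calibre `(κ, lam, μ)`: every `κ`-sized subset contains a `lam`-sized subset `S` such that
every `μ`-sized subset of `S` is bounded. -/
def Calibre₃ (κ lam μ : Cardinal.{u}) (P : Type u) [LE P] : Prop :=
  ∀ A : Set P, #A = κ → ∃ S ⊆ A, #S = lam ∧ ∀ T ⊆ S, #T = μ → BddAbove T

/-- Calibre `(κ, lam, μ, ν)`: every `κ`-sized subset contains a `lam`-sized subset `S` such that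
every `μ`-sized subset of `S` contains a bounded `ν`-sized subset. -/
def Calibre₄ (κ lam μ ν : Cardinal.{u}) (P : Type u) [LE P] : Prop :=
  ∀ A : Set P, #A = κ → ∃ S ⊆ A, #S = lam ∧
    ∀ T ⊆ S, #T = μ → ∃ U ⊆ T, #U = ν ∧ BddAbove U

/-- `P'` has relative calibre `κ` in `P`: every `κ`-sized subset of `P'` contains a `κ`-sized
subset which is bounded in `P`. -/
def RelCalibre (κ : Cardinal.{u}) {P : Type u} [LE P] (P' : Set P) : Prop :=
  ∀ A ⊆ P', #A = κ → ∃ S ⊆ A, #S = κ ∧ BddAbove S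

/-- Productively calibre `(ω₁, ω)`: `P × Q` has calibre `(ω₁, ω)` for every directed set `Q`
(in the universe `v`) that has calibre `(ω₁, ω)`. -/
def ProductivelyCalibre (P : Type u) [LE P] : Prop :=
  ∀ (Q : Type v) [PartialOrder Q] [Nonempty Q] [IsDirectedOrder Q],
    Calibre₂ ℵ₁ ℵ₀ Q → Calibre₂ ℵ₁ ℵ₀ (P × Q)

/-- Powerfully calibre `(ω₁, ω)`: the countable power of `P` has calibre `(ω₁, ω)`. -/
def PowerfullyCalibre (P : Type u) [LE P] : Prop :=
  Calibre₂ ℵ₁ ℵ₀ (ℕ → P)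

/-! ### Types -/

/-- `P` is of type `(Q, R)`: it is covered by a `Q`-ordered family of subsets having property
`R`. -/
def IsOfType (P : Type*) (Q : Type*) [Preorder Q] (R : Set P → Prop) : Prop :=
  ∃ F : Q → Set P, Monotone F ∧ ⋃ q, F q = Set.univ ∧ ∀ q, R (F q)

/-! ### Topological directed sets -/

/-- CSB: every convergent sequence is bounded. -/
def IsCSB (P : Type*) [LE P] [TopologicalSpace P] : Prop :=
  ∀ (x : ℕ → P) (p : P), Tendsto x atTop (𝓝 p) → BddAbove (range x)

/-- CSBS: every convergent sequence has a bounded subsequence. -/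
def IsCSBS (P : Type*) [LE P] [TopologicalSpace P] : Prop :=
  ∀ (x : ℕ → P) (p : P), Tendsto x atTop (𝓝 p) →
    ∃ k : ℕ → ℕ, StrictMono k ∧ BddAbove (range (x ∘ k))

/-- The bounding number `𝔟`: the least size of a subset of `ω^ω` that is unbounded in the
mod-finite order. -/
noncomputable def boundingNumber : Cardinal.{0} :=
  sInf {κ | ∃ B : Set (ℕ → ℕ), #B = κ ∧ ¬ ∃ g : ℕ → ℕ, ∀ f ∈ B, ∀ᶠ n in atTop, f n ≤ g n}

/-! ### Compact sets of bounded Cantor–Bendixson height -/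

/-- `K` has Cantor–Bendixson height `γ`: `γ` is the least ordinal such that the derivative of
`K` of order `γ + 1` is empty. A nonempty compact set has height `γ` iff its derivative of order
`γ` is finite and nonempty. Sets with a nonempty perfect kernel have no height. -/
def HasCBHeight {X : Type} [TopologicalSpace X] (K : Set X) (γ : Ordinal.{0}) : Prop :=
  IsLeast {δ : Ordinal.{0} | CantorBendixson.iteratedDerivedSet K (δ + 1) = ∅} γ

/-- The compact subsets of `2^ω` of Cantor–Bendixson height `< α`. As a type, it carries the order
by inclusion and the subspace topology of the Vietoris topology. -/
def compactsCBLT (α : Ordinal.{0}) : Set (Compacts (ℕ → Bool)) :=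
  {K | ∃ γ < α, HasCBHeight (K : Set (ℕ → Bool)) γ}

theorem iteratedDerivedSet_union {X : Type} [TopologicalSpace X] {s t : Set X}
    (hs : IsClosed s) (ht : IsClosed t) (a : Ordinal.{0}) :
    CantorBendixson.iteratedDerivedSet (s ∪ t) a =
      CantorBendixson.iteratedDerivedSet s a ∪ CantorBendixson.iteratedDerivedSet t a := by
  induction a using Ordinal.limitRecOn with
  | zero => simp
  | add_one a ih =>
    have h1 := CantorBendixson.isClosed_iteratedDerivedSet hs a
    have h2 := CantorBendixson.isClosed_iteratedDerivedSet ht a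
    rw [CantorBendixson.iteratedDerivedSet_succ, CantorBendixson.iteratedDerivedSet_succ,
      CantorBendixson.iteratedDerivedSet_succ, ih, (h1.union h2).relDerivedSet_eq,
      h1.relDerivedSet_eq, h2.relDerivedSet_eq, derivedSet_union]
  | limit a ha ih =>
    rw [CantorBendixson.iteratedDerivedSet_limit ha, CantorBendixson.iteratedDerivedSet_limit ha,
      CantorBendixson.iteratedDerivedSet_limit ha, ← Set.iInter_union_of_antitone
        (fun (i j : Set.Iio a) (h : i ≤ j) => CantorBendixson.iteratedDerivedSet_antitone s h)
        (fun (i j : Set.Iio a) (h : i ≤ j) => CantorBendixson.iteratedDerivedSet_antitone t h)]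
    exact Set.iInter_congr fun i => ih i i.2

theorem mem_compactsCBLT {α : Ordinal.{0}} {K : Compacts (ℕ → Bool)} :
    K ∈ compactsCBLT α ↔
      ∃ γ < α, CantorBendixson.iteratedDerivedSet (K : Set (ℕ → Bool)) (γ + 1) = ∅ := by
  constructor
  · rintro ⟨γ, hγ, h⟩
    exact ⟨γ, hγ, h.1⟩
  · rintro ⟨γ, hγ, h⟩
    have hne : {δ : Ordinal.{0} | CantorBendixson.iteratedDerivedSet
        (K : Set (ℕ → Bool)) (δ + 1) = ∅}.Nonempty := ⟨γ, h⟩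
    exact ⟨_, (csInf_le' (s := {δ : Ordinal.{0} | CantorBendixson.iteratedDerivedSet
        (K : Set (ℕ → Bool)) (δ + 1) = ∅}) h).trans_lt hγ, csInf_mem hne, fun _ hδ => csInf_le' hδ⟩

instance instIsDirectedOrderCompactsCBLT (α : Ordinal.{0}) : IsDirectedOrder (compactsCBLT α) where
  directed := by
    rintro ⟨K, hK⟩ ⟨L, hL⟩
    obtain ⟨γ, hγ, h⟩ := mem_compactsCBLT.1 hK
    obtain ⟨δ, hδ, h'⟩ := mem_compactsCBLT.1 hL
    refine ⟨⟨K ⊔ L, mem_compactsCBLT.2 ⟨max γ δ, max_lt hγ hδ, ?_⟩⟩,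
      le_sup_left (a := K) (b := L), le_sup_right (a := K) (b := L)⟩
    rw [Compacts.coe_sup, iteratedDerivedSet_union K.isCompact.isClosed L.isCompact.isClosed,
      Set.union_empty_iff]
    refine ⟨Set.subset_empty_iff.1 (h ▸ CantorBendixson.iteratedDerivedSet_antitone _ ?_),
      Set.subset_empty_iff.1 (h' ▸ CantorBendixson.iteratedDerivedSet_antitone _ ?_)⟩
    · gcongr
      exact le_max_left _ _
    · gcongr
      exact le_max_right _ _

/-!
Write `K^(γ)` for the Cantor–Bendixson derivative of order `γ` of a compact set `K ⊆ 2^ω`.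

The basic construction (`exists_isCompact_mem_iteratedDerivedSet`) produces, in every dense-in-itself
part of a first countable Hausdorff space, near every point `x` and for every countable `β`, a
compact set `K` with `x ∈ K^(β)` and `K^(β + 1) = ∅`.

*Successor case* `α = β + 1`. The members `K` are those with `K^(β)` finite. Taking for each `x` a
member `K_x` with `x ∈ K_x^(β)` gives continuum many elements with all infinite subfamilies
unbounded, which makes the directed set Tukey above the finite subsets of the continuum. The converse
only uses that there are at most continuum many compact sets.

*Limit case.* Compact sets of increasing rank shrinking to a point refute CSBS. A family of `ℵ₁`
singletons refutes calibre `(ω₁, ω₁, ω)`: a countable dense part of an uncountable set of points has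
uncountable closure, while all members are countable. A Tukey quotient map from `𝓚(M)` yields a map
`ψ` into `𝓚(M)` that reflects boundedness. The graph of `x ↦ ψ {x}` is an uncountable second
countable space, so it contains a compact set of rank at least `α`. By compactness `ψ` is bounded on
the corresponding singletons, so their union, of rank at least `α`, lies in a member: a contradiction.

For the positive results, refine the Vietoris topology by making the sets
`{K | K^(γ) ∩ V = ∅}`, for `γ < α` and `V` clopen, clopen as well (`fineTopology`). There are
countably many of them, so the topology stays second countable. When `L j` converges to `K` in it,
the union of `K` and a tail of the sequence has rank at most one more than `K`
(`exists_notMem_iteratedDerivedSet_union_tail`), so the fine topology is CSB (`isCSB_fineTopology`).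
Second countability and CSB pass to the countable power and imply calibre `(ω₁, ω)`. The new clopen
sets are Borel in the Vietoris topology, so with the fine topology the directed set is homeomorphic
to an analytic set, that is, to a continuous image of `ω^ω`
(`analyticSet_range_derivativeCode`); the images of the compact sets `{h | h ≤ f}` witness
type `(ω^ω, relative calibre ω)` (`IsCSB.isOfType`). Finally, if `ω₁ < 𝔟` then from `ℵ₁` many
elements uncountably many lie in a single piece of relative calibre `ω`, and the two remaining
calibre properties follow.
-/

/-! ### Cantor–Bendixson derivatives -/

section Derivative

open CantorBendixson

variable {X Y : Type} [TopologicalSpace X] [TopologicalSpace Y]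

/-- The Cantor–Bendixson derivatives are local: they commute with restriction to an open set. -/
theorem iteratedDerivedSet_inter_of_isOpen (s : Set X) {U : Set X} (hU : IsOpen U)
    (a : Ordinal.{0}) : (s ∩ U)ᵈ[a] = sᵈ[a] ∩ U := by
  induction a using Ordinal.limitRecOn with
  | zero => simp
  | add_one a ih =>
    rw [iteratedDerivedSet_succ, iteratedDerivedSet_succ, ih]
    ext x
    simp only [relDerivedSet_apply, mem_inter_iff, mem_derivedSet, accPt_iff_nhds]
    constructor
    · rintro ⟨h, hx, hxU⟩
      refine ⟨⟨fun V hV => ?_, hx⟩, hxU⟩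
      obtain ⟨y, hy, hne⟩ := h V hV
      exact ⟨y, ⟨hy.1, hy.2.1⟩, hne⟩
    · rintro ⟨⟨h, hx⟩, hxU⟩
      refine ⟨fun V hV => ?_, hx, hxU⟩
      obtain ⟨y, hy, hne⟩ := h (V ∩ U) (inter_mem hV (hU.mem_nhds hxU))
      exact ⟨y, ⟨hy.1.1, hy.2, hy.1.2⟩, hne⟩
  | limit a ha ih =>
    have : Nonempty (Iio a) := ⟨⟨0, ha.bot_lt⟩⟩
    rw [iteratedDerivedSet_limit ha, iteratedDerivedSet_limit ha, iInter_inter]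
    exact iInter_congr fun i => ih i i.2

theorem image_iteratedDerivedSet_subset {f : X → Y} (hf : Continuous f)
    (hinj : Function.Injective f) (s : Set X) (a : Ordinal.{0}) :
    f '' sᵈ[a] ⊆ (f '' s)ᵈ[a] := by
  induction a using Ordinal.limitRecOn with
  | zero => simp
  | add_one a ih =>
    rw [iteratedDerivedSet_succ, iteratedDerivedSet_succ]
    rintro _ ⟨x, ⟨hx, hxs⟩, rfl⟩
    exact ⟨derivedSet_mono _ _ ih (hf.image_derivedSet hinj ⟨x, hx, rfl⟩), ih ⟨x, hxs, rfl⟩⟩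
  | limit a ha ih =>
    rw [iteratedDerivedSet_limit ha, iteratedDerivedSet_limit ha]
    rintro _ ⟨x, hx, rfl⟩
    rw [mem_iInter] at hx ⊢
    exact fun i => ih i i.2 ⟨x, hx i, rfl⟩

theorem iteratedDerivedSet_subset (s : Set X) (a : Ordinal.{0}) : sᵈ[a] ⊆ s := by
  simpa using iteratedDerivedSet_antitone s (zero_le (a := a))

theorem iteratedDerivedSet_subset_of_subset {s t : Set X} (h : s ⊆ t) (a : Ordinal.{0}) :
    sᵈ[a] ⊆ tᵈ[a] :=
  iteratedDerivedSet_mono h a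

@[simp]
theorem iteratedDerivedSet_empty (a : Ordinal.{0}) : (∅ : Set X)ᵈ[a] = ∅ :=
  subset_empty_iff.1 (iteratedDerivedSet_subset _ _)

theorem iteratedDerivedSet_biUnion_of_finite {ι : Type*} {I : Set ι} (hI : I.Finite)
    {s : ι → Set X} (hs : ∀ i, IsClosed (s i)) (a : Ordinal.{0}) :
    (⋃ i ∈ I, s i)ᵈ[a] = ⋃ i ∈ I, (s i)ᵈ[a] := by
  induction I, hI using Set.Finite.induction_on with
  | empty => simp
  | @insert i I _ hI ih =>
    rw [biUnion_insert, biUnion_insert,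
      iteratedDerivedSet_union (hs i) (hI.isClosed_biUnion fun i _ => hs i), ih]

/-- If a derivative meets some neighbourhood of `x` in at most `x`, then `x` is not in the next
derivative. -/
theorem notMem_iteratedDerivedSet_succ {s U : Set X} {x : X} (hU : U ∈ 𝓝 x) {a : Ordinal.{0}}
    (h : ∀ y ∈ U, y ≠ x → y ∉ sᵈ[a]) : x ∉ sᵈ[a + 1] := by
  rw [iteratedDerivedSet_succ]
  rintro ⟨hx, -⟩
  obtain ⟨y, hy, hne⟩ := accPt_iff_nhds.1 hx U hU
  exact h y hy.1 hne hy.2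

theorem exists_isOpen_of_notMem_iteratedDerivedSet_succ {s : Set X} {x : X} {a : Ordinal.{0}}
    (hx : x ∈ sᵈ[a]) (hx' : x ∉ sᵈ[a + 1]) :
    ∃ U, IsOpen U ∧ x ∈ U ∧ ∀ y ∈ U, y ≠ x → y ∉ sᵈ[a] := by
  have h : ¬ AccPt x (𝓟 sᵈ[a]) := fun h =>
    hx' (by rw [iteratedDerivedSet_succ]; exact ⟨h, hx⟩)
  rw [accPt_iff_nhds] at h
  push Not at h
  obtain ⟨V, hV, h⟩ := h
  obtain ⟨U, hUV, hU, hxU⟩ := mem_nhds_iff.1 hV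
  exact ⟨U, hU, hxU, fun y hy hne hys => hne (h y ⟨hUV hy, hys⟩)⟩

/-- The least order of a derivative of `s` avoiding a point of `s` is a successor. -/
theorem exists_mem_iteratedDerivedSet_notMem_succ {s : Set X} {x : X} (hx : x ∈ s)
    {a : Ordinal.{0}} (ha : x ∉ sᵈ[a]) :
    ∃ b < a, x ∈ sᵈ[b] ∧ x ∉ sᵈ[b + 1] := by
  induction a using Ordinal.limitRecOn with
  | zero => simp [hx] at ha
  | add_one a ih =>
    by_cases h : x ∈ sᵈ[a]
    · exact ⟨a, lt_add_one a, h, ha⟩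
    · obtain ⟨b, hb, h⟩ := ih h
      exact ⟨b, hb.trans (lt_add_one a), h⟩
  | limit a hlim ih =>
    rw [iteratedDerivedSet_limit hlim, mem_iInter] at ha
    push Not at ha
    obtain ⟨i, hi⟩ := ha
    obtain ⟨b, hb, h⟩ := ih i i.2 hi
    exact ⟨b, hb.trans i.2, h⟩

theorem finite_of_iteratedDerivedSet_succ_eq_empty {K : Set X} (hK : IsCompact K)
    (hK' : IsClosed K) {a : Ordinal.{0}} (h : Kᵈ[a + 1] = ∅) : (Kᵈ[a]).Finite := by
  by_contra hinf
  have hc : IsClosed Kᵈ[a] := isClosed_iteratedDerivedSet hK' a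
  obtain ⟨x, hx, hacc⟩ := Set.Infinite.exists_accPt_of_subset_isCompact hinf
    (hK.of_isClosed_subset hc (iteratedDerivedSet_subset K a)) Subset.rfl
  have : x ∈ Kᵈ[a + 1] := by
    rw [iteratedDerivedSet_succ]
    exact ⟨hacc, hx⟩
  simp [h] at this

end Derivative

/-! ### Compact sets with prescribed Cantor–Bendixson rank -/

section Existence

open CantorBendixson

/-- A nonzero countable ordinal has a cofinal sequence; allowing repetitions, this makes sense for
successors as well. -/
theorem exists_seq_eventually_ge {β : Ordinal.{0}} (hβ : (Iio β).Countable) (h0 : β ≠ 0) :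
    ∃ b : ℕ → Ordinal.{0}, (∀ n, b n < β) ∧ ∀ γ < β, ∀ᶠ n in atTop, γ ≤ b n := by
  have hpos : 0 < β := pos_iff_ne_zero.2 h0
  obtain ⟨e, he⟩ := hβ.exists_eq_range ⟨0, hpos⟩
  refine ⟨fun n => (Finset.range (n + 1)).sup e, fun n => ?_, fun γ hγ => ?_⟩
  · refine (Finset.sup_lt_iff hpos).2 fun i _ => ?_
    have : e i ∈ Iio β := he ▸ mem_range_self i
    exact this
  · obtain ⟨k, rfl⟩ : γ ∈ range e := he ▸ hγ
    filter_upwards [eventually_ge_atTop k] with n hn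
    exact Finset.le_sup (f := e) (by simpa using Nat.lt_succ_of_le hn)

theorem isCompact_insert_iUnion_of_shrinking {Y : Type*} [TopologicalSpace Y] {x : Y}
    {U : ℕ → Set Y} (hU : (𝓝 x).HasAntitoneBasis U) {K : ℕ → Set Y} (hK : ∀ n, IsCompact (K n))
    (hKU : ∀ n, K n ⊆ U n) : IsCompact (insert x (⋃ n, K n)) := by
  rw [isCompact_iff_ultrafilter_le_nhds]
  intro F hF
  by_cases hx : ↑F ≤ 𝓝 x
  · exact ⟨x, mem_insert _ _, hx⟩
  rw [hU.1.ge_iff] at hx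
  push Not at hx
  obtain ⟨n, -, hn⟩ := hx
  have hmem : (⋃ i ∈ Iio n, K i) ∈ F := by
    filter_upwards [Ultrafilter.compl_mem_iff_notMem.2 hn, le_principal_iff.1 hF] with y hy hyK
    rcases hyK with rfl | hyK
    · exact absurd (mem_of_mem_nhds (hU.1.mem_of_mem trivial)) hy
    · obtain ⟨i, hi⟩ := mem_iUnion.1 hyK
      refine mem_biUnion (show i < n from ?_) hi
      by_contra! hle
      exact hy (hU.antitone hle (hKU i hi))
  obtain ⟨y, hy, hle⟩ := isCompact_iff_ultrafilter_le_nhds.1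
    ((finite_Iio n).isCompact_biUnion fun i _ => hK i) F (le_principal_iff.2 hmem)
  obtain ⟨i, -, hi⟩ := mem_iUnion₂.1 hy
  exact ⟨y, mem_insert_of_mem _ (mem_iUnion_of_mem i hi), hle⟩

/-- Arbitrarily close to any point of a dense-in-itself set there are compact sets of every
countable Cantor–Bendixson rank, with the given point in the last nonempty derivative. Such a set
of rank `β` is obtained by adding `x` to a sequence of compact sets which shrink to `x` and whose
ranks are cofinal in `β`. -/
theorem exists_isCompact_mem_iteratedDerivedSet {Y : Type} [TopologicalSpace Y] [T2Space Y]
    [FirstCountableTopology Y] {D : Set Y} (hD : Preperfect D) {β : Ordinal.{0}}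
    (hβ : (Iio β).Countable) {x : Y} (hx : x ∈ D) {U : Set Y} (hU : U ∈ 𝓝 x) :
    ∃ K ⊆ U, IsCompact K ∧ x ∈ Kᵈ[β] ∧ Kᵈ[β + 1] = ∅ := by
  induction β using WellFoundedLT.induction generalizing x U with
  | ind β ih =>
  rcases eq_or_ne β 0 with rfl | h0
  · refine ⟨{x}, singleton_subset_iff.2 (mem_of_mem_nhds hU), isCompact_singleton, by simp, ?_⟩
    refine eq_empty_of_forall_notMem fun y hy => ?_
    rw [iteratedDerivedSet_succ, iteratedDerivedSet_zero] at hy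
    obtain ⟨hacc, rfl⟩ := hy
    obtain ⟨z, hz, hne⟩ := accPt_iff_nhds.1 hacc univ univ_mem
    exact hne hz.2
  obtain ⟨b, hb, hcof⟩ := exists_seq_eventually_ge hβ h0
  obtain ⟨B, hB⟩ := (𝓝 x).exists_antitone_basis
  have hpt : ∀ n, ∃ y ∈ D, y ≠ x ∧ U ∩ B n ∈ 𝓝 y := by
    intro n
    have hmem : interior (U ∩ B n) ∈ 𝓝 x :=
      interior_mem_nhds.2 (inter_mem hU (hB.1.mem_of_mem trivial))
    obtain ⟨y, hy, hne⟩ := accPt_iff_nhds.1 (hD x hx) _ hmem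
    exact ⟨y, hy.2, hne, mem_interior_iff_mem_nhds.1 hy.1⟩
  choose y hyD hyx hyU using hpt
  have hK : ∀ n, ∃ K ⊆ U ∩ B n, IsCompact K ∧ y n ∈ Kᵈ[b n] ∧ Kᵈ[b n + 1] = ∅ := fun n =>
    ih (b n) (hb n) (hβ.mono (Iio_subset_Iio (hb n).le)) (hyD n) (hyU n)
  choose K hKU hKc hKy hKe using hK
  set L : Set Y := insert x (⋃ n, K n) with hL
  have hKL : ∀ n, K n ⊆ L := fun n => (subset_iUnion K n).trans (subset_insert _ _)
  refine ⟨L, ?_, isCompact_insert_iUnion_of_shrinking hB hKc fun n =>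
    (hKU n).trans inter_subset_right, ?_, ?_⟩
  · exact insert_subset (mem_of_mem_nhds hU)
      (iUnion_subset fun n => (hKU n).trans inter_subset_left)
  · have key : ∀ γ ≤ β, x ∈ Lᵈ[γ] := by
      intro γ
      induction γ using Ordinal.limitRecOn with
      | zero => intro _; simp [hL]
      | add_one γ ihγ =>
        intro hγ
        have hlt : γ < β := (lt_add_one γ).trans_le hγ
        rw [iteratedDerivedSet_succ]
        refine ⟨accPt_iff_nhds.2 fun V hV => ?_, ihγ hlt.le⟩
        obtain ⟨k, -, hk⟩ := hB.1.mem_iff.1 hV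
        obtain ⟨n, hn, hkn⟩ := ((hcof γ hlt).and (eventually_ge_atTop k)).exists
        refine ⟨y n, ⟨hk (hB.antitone hkn (mem_of_mem_nhds (hyU n)).2), ?_⟩, hyx n⟩
        exact iteratedDerivedSet_subset_of_subset (hKL n) γ (iteratedDerivedSet_antitone _ hn (hKy n))
      | limit γ hγ ihγ =>
        intro hle
        rw [iteratedDerivedSet_limit hγ, mem_iInter]
        exact fun i => ihγ i i.2 (i.2.le.trans hle)
    exact key β le_rfl
  · -- Away from `x`, the set is locally a finite union of the `K n`, whose ranks are `< β`.
    have key : ∀ z, z ≠ x → z ∉ Lᵈ[β] := by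
      intro z hz hzL
      obtain ⟨V, W, hV, hW, hzV, hxW, hVW⟩ := t2_separation hz
      obtain ⟨N, -, hN⟩ := hB.1.mem_iff.1 (hW.mem_nhds hxW)
      have hsub : L ∩ V ⊆ ⋃ n ∈ Iio N, K n := by
        rintro w ⟨hw, hwV⟩
        rcases hw with rfl | hw
        · exact absurd hxW (disjoint_left.1 hVW hwV)
        · obtain ⟨n, hn⟩ := mem_iUnion.1 hw
          refine mem_biUnion (show n < N from ?_) hn
          by_contra! hle
          exact disjoint_left.1 hVW hwV (hN (hB.antitone hle (hKU n hn).2))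
      have hmem : z ∈ (⋃ n ∈ Iio N, K n)ᵈ[β] := iteratedDerivedSet_subset_of_subset hsub β
        ((iteratedDerivedSet_inter_of_isOpen L hV β).ge ⟨hzL, hzV⟩)
      rw [iteratedDerivedSet_biUnion_of_finite (finite_Iio N) fun n => (hKc n).isClosed] at hmem
      obtain ⟨n, -, hn⟩ := mem_iUnion₂.1 hmem
      have := iteratedDerivedSet_antitone (K n) (Order.add_one_le_of_lt (hb n)) hn
      simp [hKe n] at this
    refine eq_empty_of_forall_notMem fun z => ?_
    by_cases hz : z = x
    · subst hz
      exact notMem_iteratedDerivedSet_succ univ_mem fun w _ hw => key w hw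
    · exact fun h => key z hz (iteratedDerivedSet_antitone L (lt_add_one β).le h)

/-- A closed set with an empty Cantor–Bendixson derivative is countable, since an uncountable closed
set contains a nonempty perfect set, which stays in all derivatives. -/
theorem countable_of_iteratedDerivedSet_eq_empty {Y : Type} [TopologicalSpace Y]
    [SecondCountableTopology Y] {K : Set Y} (hK : IsClosed K) {a : Ordinal.{0}}
    (h : Kᵈ[a] = ∅) : K.Countable := by
  by_contra hunc
  obtain ⟨D, hD, hne, hDK⟩ := exists_perfect_nonempty_of_isClosed_of_not_countable hK hunc
  have hsub := (hD.subset_perfectKernel hDK).trans (perfectKernel_subset_iteratedDerivedSet K a)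
  rw [h] at hsub
  exact hne.ne_empty (subset_empty_iff.1 hsub)

theorem preperfect_univ_cantor : Preperfect (univ : Set (ℕ → Bool)) := by
  intro x _
  rw [accPt_iff_nhds]
  intro U hU
  have hlim : Tendsto (fun n => Function.update x n (!x n)) atTop (𝓝 x) := by
    refine tendsto_pi_nhds.2 fun i => tendsto_const_nhds.congr' ?_
    filter_upwards [eventually_gt_atTop i] with n hn
    rw [Function.update_of_ne hn.ne]
  obtain ⟨n, hn⟩ := (hlim.eventually_mem hU).exists
  refine ⟨_, ⟨hn, trivial⟩, fun h => ?_⟩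
  have := congrFun h n
  simp at this

end Existence

/-! ### Tukey quotients and cofinal types -/

section Tukey

/-- A Tukey quotient map from `P` to `Q` provides a map `ψ : Q → P` that reflects bounds. -/
theorem TukeyGE.exists_map {P Q : Type*} [Preorder P] [LE Q] (h : TukeyGE P Q) :
    ∃ (φ : P → Q) (ψ : Q → P), ∀ q p, ψ q ≤ p → q ≤ φ p := by
  obtain ⟨φ, hφ⟩ := h
  have : ∀ q, ∃ p, ∀ p', p ≤ p' → q ≤ φ p' := by
    intro q
    by_contra! hq
    have hC : IsCofinal {p' | ¬ q ≤ φ p'} := fun p => by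
      obtain ⟨p', hp, hp'⟩ := hq p
      exact ⟨p', hp', hp⟩
    obtain ⟨_, ⟨p', hp', rfl⟩, hle⟩ := hφ _ hC q
    exact hp' hle
  choose ψ hψ using this
  exact ⟨φ, ψ, hψ⟩

theorem TukeyGE.of_map {P Q : Type*} [LE P] [Preorder Q] (φ : P → Q)
    (h : ∀ q, ∃ p, ∀ p', p ≤ p' → q ≤ φ p') : TukeyGE P Q := by
  refine ⟨φ, fun C hC q => ?_⟩
  obtain ⟨p, hp⟩ := h q
  obtain ⟨c, hc, hpc⟩ := hC p
  exact ⟨φ c, mem_image_of_mem φ hc, hp c hpc⟩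

/-- The finite subsets of `ι` are Tukey above every directed set of size at most `#ι`. -/
theorem tukeyGE_finset {ι Q : Type*} [Preorder Q] [IsDirectedOrder Q] [Nonempty Q]
    (e : ι → Q) (he : Function.Surjective e) : TukeyGE (Finset ι) Q := by
  classical
  have : ∀ F : Finset ι, ∃ q, ∀ i ∈ F, e i ≤ q := fun F => by
    obtain ⟨q, hq⟩ := (F.image e).exists_le
    exact ⟨q, fun i hi => hq _ (Finset.mem_image_of_mem e hi)⟩
  choose φ hφ using this
  refine TukeyGE.of_map φ fun q => ?_
  obtain ⟨i, rfl⟩ := he q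
  exact ⟨{i}, fun F hF => hφ F i (hF (Finset.mem_singleton_self i))⟩

/-- A directed set with an indexed family, all of whose infinite subfamilies are unbounded, is
Tukey above the finite subsets of the index set. -/
theorem tukeyGE_finset_of_finite {ι P : Type*} [Preorder P] [IsDirectedOrder P] [Nonempty P]
    (k : ι → P) (hk : ∀ p, {i | k i ≤ p}.Finite) : TukeyGE P (Finset ι) := by
  classical
  refine TukeyGE.of_map (fun p => (hk p).toFinset) fun F => ?_
  obtain ⟨p, hp⟩ := (F.image k).exists_le
  refine ⟨p, fun p' hpp' i hi => ?_⟩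
  rw [Set.Finite.mem_toFinset]
  exact (hp _ (Finset.mem_image_of_mem k hi)).trans hpp'

end Tukey

/-! ### The successor case -/

section Successor

open CantorBendixson

theorem nonempty_compactsCBLT {α : Ordinal.{0}} (hα : 0 < α) : Nonempty (compactsCBLT α) :=
  ⟨⟨⊥, mem_compactsCBLT.2 ⟨0, hα, by simp⟩⟩⟩

theorem mk_compacts_le_continuum {X : Type} [TopologicalSpace X] [T2Space X]
    [SecondCountableTopology X] : #(Compacts X) ≤ 𝔠 := by
  let f : Compacts X → Set (countableBasis X) := fun K => {V | Disjoint (V : Set X) K}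
  have hf : Function.Injective f := by
    have key : ∀ K L : Compacts X, f K = f L → (L : Set X) ⊆ K := by
      intro K L h x hx
      by_contra hxK
      obtain ⟨V, hV, hxV, hVK⟩ := (isBasis_countableBasis X).exists_subset_of_mem_open
        (show x ∈ (K : Set X)ᶜ from hxK) K.isCompact.isClosed.isOpen_compl
      have hmem : (⟨V, hV⟩ : countableBasis X) ∈ f K := disjoint_left.2 fun y hy => hVK hy
      rw [h] at hmem
      exact disjoint_left.1 hmem hxV hx
    exact fun K L h => SetLike.coe_injective ((key L K h.symm).antisymm (key K L h))
  calc #(Compacts X) ≤ #(Set (countableBasis X)) := mk_le_of_injective hf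
    _ = 2 ^ #(countableBasis X) := mk_set
    _ ≤ 2 ^ ℵ₀ :=
      power_le_power_left two_ne_zero (countable_countableBasis X).le_aleph0
    _ = 𝔠 := two_power_aleph0

theorem mk_cantor : #(ℕ → Bool) = 𝔠 := by simp

theorem mem_compactsCBLT_add_one {β : Ordinal.{0}} {K : Compacts (ℕ → Bool)} :
    K ∈ compactsCBLT (β + 1) ↔ iteratedDerivedSet (K : Set (ℕ → Bool)) (β + 1) = ∅ := by
  rw [mem_compactsCBLT]
  refine ⟨fun ⟨γ, hγ, h⟩ => ?_, fun h => ⟨β, lt_add_one β, h⟩⟩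
  refine subset_empty_iff.1 (h ▸ iteratedDerivedSet_antitone _ ?_)
  gcongr
  exact Order.lt_add_one_iff.1 hγ

/-- Choose for every point `x` a compact set having `x` in its last nonempty derivative, of order
`β`. A member of `compactsCBLT (β + 1)` contains only finitely many of these sets, as its derivative
of order `β` is finite. -/
theorem tukeyEquiv_compactsCBLT_add_one {β : Ordinal.{0}} (hβ : (Iio β).Countable) :
    TukeyEquiv (compactsCBLT (β + 1)) (Finset (Cardinal.continuum.{0}).ord.ToType) := by
  have := nonempty_compactsCBLT (show 0 < β + 1 by positivity)
  obtain ⟨e⟩ : Nonempty ((Cardinal.continuum.{0}).ord.ToType ≃ (ℕ → Bool)) :=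
    Cardinal.eq.1 (by rw [mk_ord_toType, mk_cantor])
  constructor
  · have hK : ∀ x : ℕ → Bool, ∃ K : compactsCBLT (β + 1),
        x ∈ iteratedDerivedSet (K.1 : Set (ℕ → Bool)) β := by
      intro x
      obtain ⟨K, -, hc, hx, he⟩ := exists_isCompact_mem_iteratedDerivedSet
        preperfect_univ_cantor hβ (mem_univ x) univ_mem
      exact ⟨⟨⟨K, hc⟩, mem_compactsCBLT_add_one.2 he⟩, hx⟩
    choose k hk using hK
    refine tukeyGE_finset_of_finite (fun i => k (e i)) fun K => ?_
    have hfin := finite_of_iteratedDerivedSet_succ_eq_empty K.1.isCompact K.1.isCompact.isClosed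
      (mem_compactsCBLT_add_one.1 K.2)
    refine (hfin.preimage e.injective.injOn).subset fun i hi => ?_
    exact iteratedDerivedSet_subset_of_subset (show (k (e i)).1.carrier ⊆ K.1.carrier from hi) β (hk (e i))
  · have hle : #(compactsCBLT (β + 1)) ≤ #(Cardinal.continuum.{0}).ord.ToType := by
      rw [mk_ord_toType]
      exact (mk_set_le _).trans mk_compacts_le_continuum
    obtain ⟨g⟩ := hle
    exact tukeyGE_finset (Function.invFun g) (Function.invFun_surjective g.injective)

end Successor

/-! ### The limit case: failures in the Vietoris topology -/

section Limit

open CantorBendixson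

theorem mem_compactsCBLT_of_isSuccLimit {α : Ordinal.{0}} (hα : Order.IsSuccLimit α)
    {K : Compacts (ℕ → Bool)} :
    K ∈ compactsCBLT α ↔ ∃ γ < α, iteratedDerivedSet (K : Set (ℕ → Bool)) γ = ∅ := by
  rw [mem_compactsCBLT]
  constructor
  · rintro ⟨γ, hγ, h⟩
    exact ⟨γ + 1, hα.add_one_lt hγ, h⟩
  · rintro ⟨γ, hγ, h⟩
    exact ⟨γ, hγ, subset_empty_iff.1 (h ▸ iteratedDerivedSet_antitone _ (lt_add_one γ).le)⟩

theorem iteratedDerivedSet_eq_empty_of_mem_compactsCBLT {α : Ordinal.{0}}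
    {K : Compacts (ℕ → Bool)} (hK : K ∈ compactsCBLT α) :
    iteratedDerivedSet (K : Set (ℕ → Bool)) α = ∅ := by
  obtain ⟨γ, hγ, h⟩ := mem_compactsCBLT.1 hK
  exact subset_empty_iff.1 (h ▸ iteratedDerivedSet_antitone _ (Order.add_one_le_of_lt hγ))

/-- The member `{x}` of `compactsCBLT α`. -/
def singletonCBLT {α : Ordinal.{0}} (hα : 0 < α) (x : ℕ → Bool) : compactsCBLT α :=
  ⟨{x}, mem_compactsCBLT.2 ⟨0, hα, by
    refine eq_empty_of_forall_notMem fun y hy => ?_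
    have hyx := iteratedDerivedSet_subset _ _ hy
    refine notMem_iteratedDerivedSet_succ univ_mem (fun z _ hz hzx => hz ?_) hy
    rw [iteratedDerivedSet_zero] at hzx
    simp only [Compacts.coe_singleton, mem_singleton_iff] at hyx hzx
    rw [hyx, hzx]⟩⟩

theorem singletonCBLT_le_iff {α : Ordinal.{0}} (hα : 0 < α) {x : ℕ → Bool} {K : compactsCBLT α} :
    singletonCBLT hα x ≤ K ↔ x ∈ K.1 := by
  change ((({x} : Compacts (ℕ → Bool)) : Set (ℕ → Bool)) ⊆ K.1) ↔ _
  simp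

theorem singletonCBLT_injective {α : Ordinal.{0}} (hα : 0 < α) :
    Function.Injective (singletonCBLT hα) := by
  intro x y h
  have : x ∈ (singletonCBLT hα y).1 := (singletonCBLT_le_iff hα).1 h.le
  simpa [singletonCBLT] using this

theorem tendsto_compacts_of_shrinking {X : Type*} [TopologicalSpace X] {x : X}
    {U : ℕ → Set X} (hU : (𝓝 x).HasAntitoneBasis U) {K : ℕ → Compacts X}
    (hx : ∀ n, x ∈ K n) (hKU : ∀ n, (K n : Set X) ⊆ U n) :
    Tendsto K atTop (𝓝 {x}) := by
  let _ := TopologicalSpace.vietoris X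
  rw [nhds_induced, tendsto_comap_iff, tendsto_nhds_generateFrom_iff]
  rintro _ (⟨V, hV, rfl⟩ | ⟨V, hV, rfl⟩) hmem
  · have hxV : x ∈ V := hmem (by simp)
    obtain ⟨n, -, hn⟩ := hU.1.mem_iff.1 (IsOpen.mem_nhds hV hxV)
    filter_upwards [eventually_ge_atTop n] with m hm
    exact (hKU m).trans ((hU.antitone hm).trans hn)
  · obtain ⟨y, hy, hyV⟩ := hmem
    obtain rfl : y = x := by simpa using hy
    exact Eventually.of_forall fun n => ⟨y, hx n, hyV⟩

/-- Compact sets of ranks cofinal in `α` that shrink to a point form a convergent sequence without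
bounded subsequence. -/
theorem not_isCSBS_compactsCBLT {α : Ordinal.{0}} (hα : Order.IsSuccLimit α)
    (hc : (Iio α).Countable) : ¬ IsCSBS (compactsCBLT α) := by
  intro hcsbs
  obtain ⟨b, hb, hcof⟩ := exists_seq_eventually_ge hc hα.ne_bot
  let x : ℕ → Bool := fun _ => false
  obtain ⟨B, hB⟩ := (𝓝 x).exists_antitone_basis
  have hK : ∀ n, ∃ K : compactsCBLT α, (K.1 : Set (ℕ → Bool)) ⊆ B n ∧
      x ∈ iteratedDerivedSet (K.1 : Set (ℕ → Bool)) (b n) := by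
    intro n
    obtain ⟨K, hKU, hKc, hx, he⟩ := exists_isCompact_mem_iteratedDerivedSet
      preperfect_univ_cantor (hc.mono (Iio_subset_Iio (hb n).le)) (mem_univ x)
      (hB.1.mem_of_mem (i := n) trivial)
    exact ⟨⟨⟨K, hKc⟩, mem_compactsCBLT.2 ⟨b n, hb n, he⟩⟩, hKU, hx⟩
  choose K hKB hxK using hK
  obtain ⟨k, hk, q, hq⟩ := hcsbs K (singletonCBLT hα.bot_lt x) (tendsto_subtype_rng.2
    (tendsto_compacts_of_shrinking hB (fun n => iteratedDerivedSet_subset _ _ (hxK n)) hKB))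
  obtain ⟨γ, hγ, h⟩ := (mem_compactsCBLT_of_isSuccLimit hα).1 q.2
  obtain ⟨n, hn⟩ := (hk.tendsto_atTop.eventually (hcof γ hγ)).exists
  have hle : (K (k n)).1.carrier ⊆ q.1.carrier := hq ⟨n, rfl⟩
  have := iteratedDerivedSet_subset_of_subset hle γ (iteratedDerivedSet_antitone _ hn (hxK (k n)))
  exact (h ▸ this : x ∈ (∅ : Set (ℕ → Bool)))

/-- Among `ℵ₁` many singletons there is, in every subfamily of size `ℵ₁`, a countable subfamily
whose union is dense in the union of the subfamily; it is unbounded because the members of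
`compactsCBLT α` are countable. -/
theorem not_calibre₃_compactsCBLT {α : Ordinal.{0}} (hα : 0 < α) :
    ¬ Calibre₃ ℵ₁ ℵ₁ ℵ₀ (compactsCBLT α) := by
  intro hcal
  obtain ⟨X, hX⟩ : ∃ X : Set (ℕ → Bool), #X = ℵ₁ :=
    le_mk_iff_exists_set.1 (by rw [mk_cantor]; exact aleph_one_le_continuum)
  have hinj := singletonCBLT_injective hα
  obtain ⟨S, hSA, hS, hbdd⟩ := hcal (singletonCBLT hα '' X) (by rw [mk_image_eq hinj, hX])
  set Y := singletonCBLT hα ⁻¹' S with hY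
  have hYS : singletonCBLT hα '' Y = S := by
    rw [hY, image_preimage_eq_inter_range, inter_eq_left]
    exact hSA.trans (image_subset_range _ _)
  have hYunc : ¬ Y.Countable := by
    intro h
    have h1 : S.Countable := hYS ▸ h.image _
    rw [← le_aleph0_iff_set_countable, hS] at h1
    exact aleph0_lt_aleph_one.not_ge h1
  obtain ⟨T, hTY, hTc, hYT⟩ := (IsSeparable.of_separableSpace Y).exists_countable_dense_subset
  have hTinf : T.Infinite := by
    intro hfin
    exact hYunc ((hfin.countable).mono (hfin.isClosed.closure_eq ▸ hYT))
  have hTcard : #(singletonCBLT hα '' T) = ℵ₀ := by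
    rw [mk_image_eq hinj]
    exact le_antisymm (le_aleph0_iff_set_countable.2 hTc) (infinite_iff.1 hTinf.to_subtype)
  obtain ⟨q, hq⟩ := hbdd (singletonCBLT hα '' T) (hYS ▸ image_mono hTY) hTcard
  have hTq : T ⊆ (q.1 : Set (ℕ → Bool)) := fun x hx =>
    (singletonCBLT_le_iff hα).1 (hq (mem_image_of_mem _ hx))
  have hqc : (q.1 : Set (ℕ → Bool)).Countable :=
    countable_of_iteratedDerivedSet_eq_empty q.1.isCompact.isClosed
      (iteratedDerivedSet_eq_empty_of_mem_compactsCBLT q.2)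
  exact hYunc (hqc.mono (hYT.trans (closure_minimal hTq q.1.isCompact.isClosed)))

/-- A map `g` from the Cantor set to a second countable space carries some set of a given
countable Cantor–Bendixson rank into a compact set. Indeed, the graph of `g` is an uncountable
second countable space, so it contains compact sets of all countable ranks, and the projection of
such a compact set does not have smaller rank. -/
theorem exists_iteratedDerivedSet_nonempty_isCompact_image {Z : Type*} [TopologicalSpace Z]
    [SecondCountableTopology Z] (g : (ℕ → Bool) → Z) {β : Ordinal.{0}}
    (hβ : (Iio β).Countable) :
    ∃ K : Set (ℕ → Bool), (iteratedDerivedSet K β).Nonempty ∧ IsCompact (g '' K) := by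
  -- A copy `Y` of the Cantor set, topologized as the graph of `g`.
  obtain ⟨Y, ⟨e⟩⟩ : ∃ Y : Type, Nonempty (Y ≃ (ℕ → Bool)) := ⟨_, ⟨.refl _⟩⟩
  let _ : TopologicalSpace Y := .induced (fun y => (e y, g (e y))) instTopologicalSpaceProd
  have hgraph : Continuous fun y => (e y, g (e y)) := continuous_induced_dom
  have hfst : Continuous e := continuous_fst.comp hgraph
  have hsnd : Continuous fun y => g (e y) := continuous_snd.comp hgraph
  have : T2Space Y := T2Space.of_injective_continuous e.injective hfst
  have : SecondCountableTopology Y := secondCountableTopology_induced _ _ _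
  have hunc : ¬ (univ : Set Y).Countable := by
    rw [← le_aleph0_iff_set_countable, mk_univ, Cardinal.mk_congr e, mk_cantor, not_le]
    exact aleph0_lt_continuum
  obtain ⟨D, hD, ⟨x, hx⟩, -⟩ := exists_perfect_nonempty_of_isClosed_of_not_countable
    (isClosed_univ (X := Y)) hunc
  obtain ⟨K, -, hK, hxK, -⟩ := exists_isCompact_mem_iteratedDerivedSet hD.acc hβ hx univ_mem
  refine ⟨e '' K, ⟨e x, image_iteratedDerivedSet_subset hfst e.injective K β ⟨x, hxK, rfl⟩⟩, ?_⟩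
  rw [image_image]
  exact hK.image hsnd

/-- For a Tukey quotient map from `𝓚(M)`, compactness in `𝓚(M)` provides a set of singletons that
has rank at least `α` and is nevertheless bounded. -/
theorem not_tukeyGE_compacts {α : Ordinal.{0}} (hα : 0 < α) (hc : (Iio α).Countable)
    (M : Type u) [TopologicalSpace M] [MetrizableSpace M] [SeparableSpace M] :
    ¬ TukeyGE (Compacts M) (compactsCBLT α) := by
  intro h
  obtain ⟨φ, ψ, hψ⟩ := h.exists_map
  let _ : MetricSpace M := metrizableSpaceMetric M
  have : SecondCountableTopology M := UniformSpace.secondCountable_of_separable M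
  obtain ⟨K, hne, hK⟩ := exists_iteratedDerivedSet_nonempty_isCompact_image
    (fun x => ψ (singletonCBLT hα x)) hc
  let L : Compacts M := ⟨_, Compacts.isCompact_biUnion_coe_of_isCompact hK⟩
  have hKL : K ⊆ ((φ L).1 : Set (ℕ → Bool)) := fun x hx => by
    refine (singletonCBLT_le_iff hα).1 (hψ _ _ ?_)
    exact fun y hy => mem_biUnion (mem_image_of_mem _ hx) hy
  have := hne.mono (iteratedDerivedSet_subset_of_subset hKL α)
  rw [iteratedDerivedSet_eq_empty_of_mem_compactsCBLT (φ L).2] at this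
  exact this.ne_empty rfl

end Limit

/-! ### Topological directed sets -/

section TopologicalDirectedSets

theorem Set.Infinite.mk_eq_aleph0 {α : Type u} {s : Set α} (hs : s.Infinite) (hc : s.Countable) :
    #s = ℵ₀ :=
  le_antisymm (le_aleph0_iff_set_countable.2 hc) (infinite_iff.1 hs.to_subtype)

theorem not_countable_of_mk_eq_aleph_one {α : Type u} {s : Set α} (hs : #s = ℵ₁) :
    ¬ s.Countable := by
  rw [← le_aleph0_iff_set_countable, hs, not_le]
  exact aleph0_lt_aleph_one

theorem exists_subset_mk_eq_aleph_one {α : Type u} {s : Set α} (hs : ¬ s.Countable) :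
    ∃ t ⊆ s, #t = ℵ₁ := by
  rw [← le_aleph0_iff_set_countable, not_le] at hs
  rw [← le_mk_iff_exists_subset, ← succ_aleph0]
  exact Order.succ_le_of_lt hs

/-- In a second countable space, every uncountable set contains a sequence of distinct points that
converges to a condensation point of the set. -/
theorem exists_injective_tendsto_of_not_countable {P : Type*} [TopologicalSpace P]
    [SecondCountableTopology P] {A : Set P} (hA : ¬ A.Countable) :
    ∃ (x : ℕ → P) (p : P), Function.Injective x ∧ (∀ n, x n ∈ A) ∧ Tendsto x atTop (𝓝 p) := by
  obtain ⟨p, -, hp⟩ : ∃ p ∈ A, ∀ U ∈ 𝓝 p, ¬ (U ∩ A).Countable := by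
    by_contra! h
    choose! U hU hUc using h
    obtain ⟨t, htA, htc, ht⟩ := countable_cover_nhdsWithin (s := A) (f := U)
      fun x hx => mem_nhdsWithin_of_mem_nhds (hU x hx)
    refine hA ((htc.biUnion fun x hx => hUc x (htA hx)).mono fun y hy => ?_)
    obtain ⟨x, hx, hyx⟩ := mem_iUnion₂.1 (ht hy)
    exact mem_biUnion hx ⟨hyx, hy⟩
  obtain ⟨B, hB⟩ := (𝓝 p).exists_antitone_basis
  classical
  obtain ⟨f, hf, hfr⟩ := exists_seq_of_forall_finset_exists
    (fun y : ℕ × P => y.2 ∈ B y.1 ∩ A) (fun y z => y.1 < z.1 ∧ y.2 ≠ z.2) (fun s _ => by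
      have hinf : (B (s.sup Prod.fst + 1) ∩ A).Infinite := fun hfin =>
        hp _ (hB.1.mem_of_mem trivial) hfin.countable
      obtain ⟨z, hz, hzs⟩ := hinf.exists_notMem_finset (s.image Prod.snd)
      refine ⟨(s.sup Prod.fst + 1, z), hz, fun y hy => ⟨?_, ?_⟩⟩
      · exact Nat.lt_succ_of_le (Finset.le_sup (f := Prod.fst) hy)
      · rintro rfl
        exact hzs (Finset.mem_image_of_mem _ hy))
  have hmono : StrictMono fun n => (f n).1 := strictMono_nat_of_lt_succ fun n =>
    (hfr n (n + 1) n.lt_succ_self).1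
  refine ⟨fun n => (f n).2, p, ?_, fun n => (hf n).2, ?_⟩
  · intro m n hmn
    by_contra hne
    rcases lt_or_gt_of_ne hne with h | h
    · exact (hfr m n h).2 hmn
    · exact (hfr n m h).2 hmn.symm
  · refine hB.1.tendsto_right_iff.2 fun k _ => ?_
    filter_upwards [eventually_ge_atTop k] with n hn
    exact hB.antitone (hn.trans (hmono.le_apply)) (hf n).1

/-- An uncountable set contains a convergent sequence of distinct points, which is bounded. -/
theorem IsCSB.calibre₂ {P : Type u} [LE P] [TopologicalSpace P] [SecondCountableTopology P]
    (h : IsCSB P) : Calibre₂ ℵ₁ ℵ₀ P := by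
  intro A hA
  obtain ⟨x, p, hinj, hxA, hx⟩ :=
    exists_injective_tendsto_of_not_countable (not_countable_of_mk_eq_aleph_one hA)
  exact ⟨range x, range_subset_iff.2 hxA,
    (infinite_range_of_injective hinj).mk_eq_aleph0 (countable_range x), h x p hx⟩

theorem IsCSB.pi {ι : Type*} {P : Type*} [Preorder P] [TopologicalSpace P] (h : IsCSB P) :
    IsCSB (ι → P) := by
  intro x p hx
  choose b hb using fun i => h (fun n => x n i) (p i) (tendsto_pi_nhds.1 hx i)
  exact ⟨b, forall_mem_range.2 fun n i => hb i ⟨n, rfl⟩⟩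

theorem IsCSB.powerfullyCalibre {P : Type u} [Preorder P] [TopologicalSpace P]
    [SecondCountableTopology P] (h : IsCSB P) : PowerfullyCalibre P :=
  h.pi.calibre₂

/-- If a CSB directed set is homeomorphic to an analytic set `F (ω^ω)`, then it is covered by the
`ω^ω`-ordered family of the compact sets corresponding to `F {h | h ≤ f}`, and these have relative
calibre `ω`. -/
theorem IsCSB.isOfType {P : Type u} [LE P] [TopologicalSpace P] (h : IsCSB P) {Z : Type*}
    [TopologicalSpace Z] [FirstCountableTopology Z] {e : P → Z} (he : IsInducing e)
    (ha : MeasureTheory.AnalyticSet (range e)) : IsOfType P (ℕ → ℕ) (RelCalibre ℵ₀) := by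
  rw [MeasureTheory.AnalyticSet] at ha
  rcases ha with hempty | ⟨F, hF, hrange⟩
  · have : IsEmpty P := range_eq_empty_iff.1 hempty
    exact ⟨fun _ => ∅, monotone_const, Subsingleton.elim _ _, fun _ A hA hcard => by
      have : IsEmpty A := isEmpty_coe_sort.2 (subset_empty_iff.1 hA)
      rw [mk_eq_zero] at hcard
      exact absurd hcard aleph0_ne_zero.symm⟩
  refine ⟨fun f => e ⁻¹' (F '' Iic f), fun f g hfg => preimage_mono
    (image_mono (Iic_subset_Iic.2 hfg)), ?_, fun f A hA hcard => ?_⟩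
  · refine eq_univ_of_forall fun q => ?_
    obtain ⟨f, hf⟩ : e q ∈ range F := hrange ▸ mem_range_self q
    exact mem_iUnion.2 ⟨f, f, self_mem_Iic, hf⟩
  · have hinf : A.Infinite := infinite_coe_iff.1 (infinite_iff.2 hcard.ge)
    have hcomp : IsCompact (F '' Iic f) := by
      refine IsCompact.image ?_ hF
      rw [← pi_univ_Iic]
      exact isCompact_univ_pi fun n => (finite_Iic (f n)).isCompact
    let a := hinf.natEmbedding
    obtain ⟨z, ⟨g, -, rfl⟩, k, hk, hlim⟩ := hcomp.isSeqCompact (x := fun n => e (a n))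
      fun n => hA (a n).2
    obtain ⟨q, hq⟩ : F g ∈ range e := hrange ▸ mem_range_self g
    have hinj : Function.Injective fun n => (a (k n) : P) :=
      Subtype.val_injective.comp (a.injective.comp hk.injective)
    refine ⟨range fun n => (a (k n) : P), range_subset_iff.2 fun n => (a (k n)).2,
      (infinite_range_of_injective hinj).mk_eq_aleph0 (countable_range _), h _ q ?_⟩
    rw [he.tendsto_nhds_iff, hq]
    exact hlim

end TopologicalDirectedSets

/-! ### Directed sets of type `(ω^ω, relative calibre ω)` -/

section Types

/-- Fewer than `𝔟` many functions are bounded modulo finite sets by a single function. -/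
theorem exists_forall_eventually_le {B : Set (ℕ → ℕ)} (hB : #B < boundingNumber) :
    ∃ g : ℕ → ℕ, ∀ f ∈ B, ∀ᶠ n in atTop, f n ≤ g n := by
  by_contra h
  exact hB.not_ge (csInf_le' ⟨B, rfl, h⟩)

/-- If `ℵ₁ < 𝔟`, then in a directed set of type `(ω^ω, relative calibre ω)` every family indexed
by a set of size `ℵ₁` has an uncountable subfamily in a subset of relative calibre `ω`: a bound
modulo finite for the corresponding elements of `ω^ω` becomes, after adding a constant, a pointwise
bound for uncountably many of them. -/
theorem IsOfType.exists_relCalibre_of_lt_boundingNumber {P : Type u} [LE P]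
    (h : IsOfType P (ℕ → ℕ) (RelCalibre ℵ₀)) (hb : ℵ₁ < boundingNumber) {ι : Type v}
    {A : Set ι} (hA : #A = ℵ₁) (p : ι → P) :
    ∃ S ⊆ A, ¬ S.Countable ∧ ∃ P' : Set P, RelCalibre ℵ₀ P' ∧ ∀ i ∈ S, p i ∈ P' := by
  obtain ⟨F, hF, hcov, hrel⟩ := h
  have hex : ∀ i, ∃ f, p i ∈ F f := fun i => mem_iUnion.1 (hcov ▸ mem_univ (p i))
  choose f hf using hex
  have hcard : #(f '' A) < boundingNumber := by
    refine lt_of_le_of_lt ?_ hb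
    have := mk_image_le_lift (f := f) (s := A)
    rw [hA] at this
    simpa using this
  obtain ⟨g, hg⟩ := exists_forall_eventually_le hcard
  have hAcov : A ⊆ ⋃ k : ℕ, {i ∈ A | f i ≤ fun n => g n + k} := by
    intro i hi
    obtain ⟨N, hN⟩ := eventually_atTop.1 (hg _ (mem_image_of_mem f hi))
    refine mem_iUnion.2 ⟨(Finset.range N).sup (f i), hi, fun n => ?_⟩
    rcases le_or_gt N n with hn | hn
    · exact (hN n hn).trans (Nat.le_add_right _ _)
    · exact (Finset.le_sup (f := f i) (Finset.mem_range.2 hn)).trans (Nat.le_add_left _ _)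
  have : ∃ k : ℕ, ¬ {i ∈ A | f i ≤ fun n => g n + k}.Countable := by
    by_contra! hc
    exact not_countable_of_mk_eq_aleph_one hA ((countable_iUnion hc).mono hAcov)
  obtain ⟨k, hk⟩ := this
  exact ⟨_, sep_subset _ _, hk, _, hrel _, fun i hi => hF hi.2 (hf i)⟩

theorem IsOfType.calibre₄ {P : Type} [LE P] (h : IsOfType P (ℕ → ℕ) (RelCalibre ℵ₀))
    (hb : ℵ₁ < boundingNumber) : Calibre₄ ℵ₁ ℵ₁ ℵ₀ ℵ₀ P := by
  intro A hA
  obtain ⟨S, hSA, hS, P', hP', hSP⟩ := h.exists_relCalibre_of_lt_boundingNumber hb hA id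
  obtain ⟨S', hS', hcard⟩ := exists_subset_mk_eq_aleph_one hS
  exact ⟨S', hS'.trans hSA, hcard, fun T hT hTc => hP' T (fun i hi => hSP i (hS' (hT hi))) hTc⟩

/-- Relative calibre `ω` for families instead of sets. -/
theorem RelCalibre.exists_infinite_bddAbove_image {P : Type u} [Preorder P] {P' : Set P}
    (h : RelCalibre ℵ₀ P') {ι : Type v} {I : Set ι} (hI : I.Infinite) {p : ι → P}
    (hp : ∀ i ∈ I, p i ∈ P') : ∃ J ⊆ I, J.Infinite ∧ BddAbove (p '' J) := by
  by_cases hfib : ∃ q, (I ∩ p ⁻¹' {q}).Infinite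
  · obtain ⟨q, hq⟩ := hfib
    exact ⟨_, inter_subset_left, hq, q, by rintro _ ⟨i, ⟨-, rfl⟩, rfl⟩; exact le_rfl⟩
  have himg : (p '' I).Infinite := by
    intro hfin
    refine hI ((hfin.biUnion fun q _ => not_infinite.1 (not_exists.1 hfib q)).subset fun i hi => ?_)
    exact mem_biUnion (mem_image_of_mem p hi) ⟨hi, rfl⟩
  obtain ⟨A, hA, hAinf⟩ : ∃ A ⊆ p '' I, #A = ℵ₀ :=
    le_mk_iff_exists_subset.1 (infinite_iff.1 himg.to_subtype)
  obtain ⟨S, hSA, hS, hbdd⟩ := h A (hA.trans (image_subset_iff.2 hp)) hAinf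
  have hsub : S ⊆ p '' (I ∩ p ⁻¹' S) := fun q hq => by
    obtain ⟨i, hi, rfl⟩ := hA (hSA hq)
    exact ⟨i, ⟨hi, hq⟩, rfl⟩
  refine ⟨I ∩ p ⁻¹' S, inter_subset_left, fun hfin => ?_,
    hbdd.mono (image_subset_iff.2 inter_subset_right)⟩
  exact infinite_coe_iff.1 (infinite_iff.2 hS.ge) ((hfin.image p).subset hsub)

/-- Calibre `(ω₁, ω)` for families instead of sets. -/
theorem Calibre₂.exists_infinite_bddAbove_image {Q : Type u} [Preorder Q]
    (h : Calibre₂ ℵ₁ ℵ₀ Q) {ι : Type v} {I : Set ι} (hI : ¬ I.Countable) (q : ι → Q) :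
    ∃ J ⊆ I, J.Infinite ∧ BddAbove (q '' J) := by
  by_cases hfib : ∃ r, (I ∩ q ⁻¹' {r}).Infinite
  · obtain ⟨r, hr⟩ := hfib
    exact ⟨_, inter_subset_left, hr, r, by rintro _ ⟨i, ⟨-, rfl⟩, rfl⟩; exact le_rfl⟩
  have himg : ¬ (q '' I).Countable := by
    intro hc
    refine hI ((hc.biUnion fun r _ => (not_infinite.1 (not_exists.1 hfib r)).countable).mono
      fun i hi => ?_)
    exact mem_biUnion (mem_image_of_mem q hi) ⟨hi, rfl⟩
  obtain ⟨A, hA, hAcard⟩ := exists_subset_mk_eq_aleph_one himg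
  obtain ⟨S, hSA, hS, hbdd⟩ := h A hAcard
  have hsub : S ⊆ q '' (I ∩ q ⁻¹' S) := fun r hr => by
    obtain ⟨i, hi, rfl⟩ := hA (hSA hr)
    exact ⟨i, ⟨hi, hr⟩, rfl⟩
  refine ⟨I ∩ q ⁻¹' S, inter_subset_left, fun hfin => ?_,
    hbdd.mono (image_subset_iff.2 inter_subset_right)⟩
  exact infinite_coe_iff.1 (infinite_iff.2 hS.ge) ((hfin.image q).subset hsub)

theorem IsOfType.productivelyCalibre {P : Type} [Preorder P]
    (h : IsOfType P (ℕ → ℕ) (RelCalibre ℵ₀)) (hb : ℵ₁ < boundingNumber) :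
    ProductivelyCalibre.{0, v} P := by
  intro Q _ _ _ hQ A hA
  obtain ⟨S, hSA, hS, P', hP', hSP⟩ :=
    h.exists_relCalibre_of_lt_boundingNumber hb hA Prod.fst
  obtain ⟨J, hJS, hJ, q, hq⟩ := hQ.exists_infinite_bddAbove_image hS Prod.snd
  obtain ⟨I, hIJ, hI, p, hp⟩ :=
    hP'.exists_infinite_bddAbove_image hJ fun i hi => hSP i (hJS hi)
  obtain ⟨U, hU, hUc⟩ := le_mk_iff_exists_subset.1 (infinite_iff.1 hI.to_subtype)
  refine ⟨U, hU.trans (hIJ.trans (hJS.trans hSA)), hUc, (p, q), fun i hi => ?_⟩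
  exact ⟨hp (mem_image_of_mem _ (hU hi)), hq (mem_image_of_mem _ (hIJ (hU hi)))⟩

end Types

/-! ### Limits of sequences with convergent derivatives -/

section Tail

open CantorBendixson

variable {X : Type} [TopologicalSpace X]

/-- Passing from `K` to the union of `K` with a tail of the sequence `L` raises the rank of a point
by at most one, provided that near every point outside a derivative of `K` the derivatives of the
same order of almost all `L j` vanish.

The proof is by induction on the rank. A point `x` of rank `ρ` in `K` has a neighbourhood whose
other points have smaller rank in `K`, hence rank at most `ρ` in the union with some tail; by
assumption, the finitely many sets by which two tails differ contribute rank at most `ρ` as well. -/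
theorem exists_notMem_iteratedDerivedSet_union_tail {K : Set X} {L : ℕ → Set X}
    (hL : ∀ j, IsClosed (L j)) (hJ : ∀ N, IsClosed (K ∪ ⋃ j, L (N + j))) {τ : Ordinal.{0}}
    (h : ∀ γ ≤ τ, ∀ x ∉ iteratedDerivedSet K γ,
      ∃ V ∈ 𝓝 x, ∀ᶠ j in atTop, ∀ y ∈ V, y ∉ iteratedDerivedSet (L j) γ)
    {x : X} (hx : x ∉ iteratedDerivedSet K τ) :
    ∃ N, x ∉ iteratedDerivedSet (K ∪ ⋃ j, L (N + j)) (τ + 1) := by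
  induction τ using WellFoundedLT.induction generalizing x with
  | ind τ ih =>
  by_cases hxK : x ∈ K
  · obtain ⟨ρ, hρ, hmem, hnot⟩ := exists_mem_iteratedDerivedSet_notMem_succ hxK hx
    have hρτ : ρ + 1 ≤ τ := Order.add_one_le_of_lt hρ
    obtain ⟨U, hU, hxU, hUK⟩ := exists_isOpen_of_notMem_iteratedDerivedSet_succ hmem hnot
    obtain ⟨V, hV, hVL⟩ := h (ρ + 1) hρτ x hnot
    obtain ⟨N, hN⟩ := eventually_atTop.1 hVL
    refine ⟨N, fun hxJ => ?_⟩
    have hxJ' := iteratedDerivedSet_antitone _ (show ρ + 1 + 1 ≤ τ + 1 by gcongr) hxJ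
    refine notMem_iteratedDerivedSet_succ (inter_mem (hU.mem_nhds hxU) hV)
      (fun y hy hyx hyJ => ?_) hxJ'
    obtain ⟨N', hN'⟩ := ih ρ hρ (fun γ hγ => h γ (hγ.trans hρ.le)) (hUK y hy.1 hyx)
    have hsub : K ∪ ⋃ j, L (N + j) ⊆
        (K ∪ ⋃ j, L (N' + j)) ∪ ⋃ j ∈ Iio N', L (N + j) := by
      refine union_subset (subset_union_left.trans subset_union_left)
        (iUnion_subset fun j => ?_)
      rcases lt_or_ge j N' with hj | hj
      · exact (subset_biUnion_of_mem (u := fun j => L (N + j)) (mem_Iio.2 hj)).trans subset_union_right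
      · refine Subset.trans ?_ (subset_union_right.trans subset_union_left)
        refine Subset.trans (Eq.subset ?_) (subset_iUnion _ (N + (j - N')))
        congr 1
        omega
    have hyJ' := iteratedDerivedSet_subset_of_subset hsub (ρ + 1) hyJ
    rw [iteratedDerivedSet_union (hJ N') ((finite_Iio N').isClosed_biUnion fun j _ => hL _),
      iteratedDerivedSet_biUnion_of_finite (finite_Iio N') fun j => hL _] at hyJ'
    rcases hyJ' with hy' | hy'
    · exact hN' hy'
    · obtain ⟨j, -, hj⟩ := mem_iUnion₂.1 hy'
      exact hN _ (Nat.le_add_right N j) y hy.2 hj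
  · obtain ⟨V, hV, hVL⟩ := h 0 (zero_le (a := τ)) x (by simpa using hxK)
    obtain ⟨N, hN⟩ := eventually_atTop.1 hVL
    refine ⟨N, fun hxJ => ?_⟩
    rcases iteratedDerivedSet_subset _ _ hxJ with h' | h'
    · exact hxK h'
    · obtain ⟨j, hj⟩ := mem_iUnion.1 h'
      exact hN _ (Nat.le_add_right N j) x (mem_of_mem_nhds hV) (by simpa using hj)

/-- The uniform version of `exists_notMem_iteratedDerivedSet_union_tail`: by compactness, one tail
works for all points. -/
theorem exists_iteratedDerivedSet_union_tail_eq_empty [CompactSpace X] {K : Set X} {L : ℕ → Set X}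
    (hL : ∀ j, IsClosed (L j)) (hJ : ∀ N, IsClosed (K ∪ ⋃ j, L (N + j))) {τ : Ordinal.{0}}
    (h : ∀ γ ≤ τ, ∀ x ∉ iteratedDerivedSet K γ,
      ∃ V ∈ 𝓝 x, ∀ᶠ j in atTop, ∀ y ∈ V, y ∉ iteratedDerivedSet (L j) γ)
    (hK : iteratedDerivedSet K τ = ∅) :
    ∃ N, iteratedDerivedSet (K ∪ ⋃ j, L (N + j)) (τ + 1) = ∅ := by
  by_contra! hne
  have hclosed : ∀ N, IsClosed (iteratedDerivedSet (K ∪ ⋃ j, L (N + j)) (τ + 1)) := fun N =>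
    isClosed_iteratedDerivedSet (hJ N) _
  obtain ⟨x, hx⟩ := IsCompact.nonempty_iInter_of_sequence_nonempty_isCompact_isClosed
    (fun N => iteratedDerivedSet (K ∪ ⋃ j, L (N + j)) (τ + 1)) (fun N => by
      refine iteratedDerivedSet_subset_of_subset (union_subset_union_right _ ?_) _
      refine iUnion_subset fun j => Subset.trans (Eq.subset ?_) (subset_iUnion _ (j + 1))
      congr 1
      omega) hne (hclosed 0).isCompact hclosed
  obtain ⟨N, hN⟩ := exists_notMem_iteratedDerivedSet_union_tail hL hJ h (x := x) (by simp [hK])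
  exact hN (mem_iInter.1 hx N)

end Tail

/-! ### The fine topology in the limit case -/

section Fine

open CantorBendixson

/-- The code of a compact set `K`: the set itself, together with the truth values of
"the derivative of `K` of order `γ` misses `V`", for `γ < α` and `V` clopen. -/
noncomputable def derivativeCode (α : Ordinal.{0}) (K : Compacts (ℕ → Bool)) :
    Compacts (ℕ → Bool) × (Clopens (ℕ → Bool) × Iio α → Bool) :=
  open scoped Classical in
  (K, fun p => decide (iteratedDerivedSet (K : Set (ℕ → Bool)) p.2 ∩ p.1 = ∅))

/-- The topology on `compactsCBLT α` induced by the codes, in which the truth values are discrete.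
It refines the Vietoris topology by making the sets of all `K` whose derivative of order `γ` misses
`V` clopen, for `γ < α` and `V` clopen. -/
@[reducible]
noncomputable def fineTopology (α : Ordinal.{0}) : TopologicalSpace (compactsCBLT α) :=
  .induced (fun K => derivativeCode α K) instTopologicalSpaceProd

variable {α : Ordinal.{0}}

theorem fineTopology_le : fineTopology α ≤ instTopologicalSpaceSubtype := by
  let _ := fineTopology α
  have h : Continuous fun K : compactsCBLT α => (derivativeCode α K).1 :=
    continuous_fst.comp continuous_induced_dom
  exact continuous_iff_le_induced.1 h

theorem countable_clopens_cantor : Countable (Clopens (ℕ → Bool)) :=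
  Clopens.countable_iff_secondCountable.2 inferInstance

theorem secondCountableTopology_fineTopology (hc : (Iio α).Countable) :
    @SecondCountableTopology (compactsCBLT α) (fineTopology α) := by
  have := hc.to_subtype
  have := countable_clopens_cantor
  exact secondCountableTopology_induced _ _ _

/-- If `L j` converges to `K` in the fine topology, the union of `K` with some tail of the sequence
has rank at most one more than `K`. -/
theorem isCSB_fineTopology (hα : Order.IsSuccLimit α) :
    @IsCSB (compactsCBLT α) _ (fineTopology α) := by
  let _ := fineTopology α
  intro L K hlim
  have hcode : Tendsto (fun j => derivativeCode α (L j)) atTop (𝓝 (derivativeCode α K)) :=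
    (continuous_induced_dom.tendsto K).comp hlim
  have hviet : Tendsto (fun j => (L j).1) atTop (𝓝 K.1) :=
    (continuous_fst.tendsto _).comp hcode
  have hval : ∀ p : Clopens (ℕ → Bool) × Iio α,
      iteratedDerivedSet (K.1 : Set (ℕ → Bool)) p.2 ∩ p.1 = ∅ →
      ∀ᶠ j in atTop, iteratedDerivedSet ((L j).1 : Set (ℕ → Bool)) p.2 ∩ p.1 = ∅ := by
    intro p hp
    have h := tendsto_pi_nhds.1 ((continuous_snd.tendsto _).comp hcode) p
    rw [nhds_discrete, tendsto_pure] at h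
    filter_upwards [h] with j hj
    simpa [derivativeCode, hp] using hj
  have hJc : ∀ N, IsCompact ((K.1 : Set (ℕ → Bool)) ∪ ⋃ j, ((L (N + j)).1 : Set (ℕ → Bool))) := by
    intro N
    have ht : Tendsto (fun j => (L (N + j)).1) atTop (𝓝 K.1) := by
      simpa only [add_comm N] using (tendsto_add_atTop_iff_nat N).2 hviet
    have := Compacts.isCompact_biUnion_coe_of_isCompact ht.isCompact_insert_range
    rwa [biUnion_insert, biUnion_range] at this
  obtain ⟨γ, hγ, hK⟩ := (mem_compactsCBLT_of_isSuccLimit hα).1 K.2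
  have hsep : ∀ δ ≤ γ, ∀ x ∉ iteratedDerivedSet (K.1 : Set (ℕ → Bool)) δ, ∃ V ∈ 𝓝 x,
      ∀ᶠ j in atTop, ∀ y ∈ V, y ∉ iteratedDerivedSet ((L j).1 : Set (ℕ → Bool)) δ := by
    intro δ hδ x hx
    -- Separate `x` from the derivative of `K` by a clopen set, which is part of the code.
    have hopen := (isClosed_iteratedDerivedSet K.1.isCompact.isClosed δ).isOpen_compl
    obtain ⟨V, hV, hxV, hVK⟩ := compact_exists_isClopen_in_isOpen hopen hx
    refine ⟨V, hV.isOpen.mem_nhds hxV, ?_⟩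
    filter_upwards [hval (⟨V, hV⟩, ⟨δ, hδ.trans_lt hγ⟩) (by
      rw [← disjoint_iff_inter_eq_empty, disjoint_right]
      exact hVK)] with j hj y hy hyL
    exact eq_empty_iff_forall_notMem.1 hj y ⟨hyL, hy⟩
  obtain ⟨N, hN⟩ := exists_iteratedDerivedSet_union_tail_eq_empty
    (L := fun j => ((L j).1 : Set (ℕ → Bool))) (fun j => (L j).1.isCompact.isClosed)
    (fun N => (hJc N).isClosed) hsep hK
  let J : compactsCBLT α := ⟨⟨_, hJc N⟩,
    (mem_compactsCBLT_of_isSuccLimit hα).2 ⟨γ + 1, hα.add_one_lt hγ, hN⟩⟩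
  have := nonempty_compactsCBLT hα.bot_lt
  have hfin : BddAbove (L '' Iio N) := ((finite_Iio N).image L).bddAbove
  have htail : BddAbove (L '' Ici N) := by
    refine ⟨J, ?_⟩
    rintro _ ⟨j, hj, rfl⟩
    obtain ⟨i, rfl⟩ := Nat.exists_eq_add_of_le (mem_Ici.1 hj)
    exact (subset_iUnion (fun i => ((L (N + i)).1 : Set (ℕ → Bool))) i).trans
      subset_union_right
  have := hfin.union htail
  rwa [← image_union, Iio_union_Ici, image_univ] at this

/-! ### Definability of the Cantor–Bendixson derivatives -/

/-- By compactness of `V`, the derivative of order `γ + 1` misses `V` iff `V` is covered by finitely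
many clopen sets, each of which meets the derivative of order `γ` in at most one point. -/
theorem iteratedDerivedSet_succ_inter_eq_empty_iff {K : Set (ℕ → Bool)} (hK : IsClosed K)
    {γ : Ordinal.{0}} (V : Clopens (ℕ → Bool)) :
    iteratedDerivedSet K (γ + 1) ∩ V = ∅ ↔
      ∃ F : Finset (Clopens (ℕ → Bool)), (V : Set (ℕ → Bool)) ⊆ ⋃ W ∈ F, (W : Set (ℕ → Bool)) ∧
        ∀ W ∈ F, ∀ A B : Clopens (ℕ → Bool), Disjoint (A : Set (ℕ → Bool)) B →
          iteratedDerivedSet K γ ∩ ((W ⊓ A : Clopens _) : Set (ℕ → Bool)) = ∅ ∨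
          iteratedDerivedSet K γ ∩ ((W ⊓ B : Clopens _) : Set (ℕ → Bool)) = ∅ := by
  have hclosed := isClosed_iteratedDerivedSet hK γ
  constructor
  · intro h
    have hloc : ∀ x ∈ (V : Set (ℕ → Bool)), ∃ W : Clopens (ℕ → Bool), x ∈ W ∧
        (iteratedDerivedSet K γ ∩ W).Subsingleton := by
      intro x hx
      have hxnot : x ∉ iteratedDerivedSet K (γ + 1) := fun hxK =>
        eq_empty_iff_forall_notMem.1 h x ⟨hxK, hx⟩
      by_cases hxγ : x ∈ iteratedDerivedSet K γ
      · obtain ⟨U, hU, hxU, hUK⟩ := exists_isOpen_of_notMem_iteratedDerivedSet_succ hxγ hxnot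
        obtain ⟨W, hW, hxW, hWU⟩ := compact_exists_isClopen_in_isOpen hU hxU
        refine ⟨⟨W, hW⟩, hxW, fun y hy z hz => ?_⟩
        have hy' : y = x := by_contra fun hne => hUK y (hWU hy.2) hne hy.1
        have hz' : z = x := by_contra fun hne => hUK z (hWU hz.2) hne hz.1
        rw [hy', hz']
      · obtain ⟨W, hW, hxW, hWU⟩ := compact_exists_isClopen_in_isOpen hclosed.isOpen_compl hxγ
        exact ⟨⟨W, hW⟩, hxW, fun y hy => absurd hy.1 (hWU hy.2)⟩
    choose! W hxW hW using hloc
    obtain ⟨t, htV, ht⟩ := V.isClopen.isClosed.isCompact.elim_nhds_subcover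
      (fun x => (W x : Set (ℕ → Bool))) fun x hx => (W x).isClopen.isOpen.mem_nhds (hxW x hx)
    classical
    refine ⟨t.image W, by simpa using ht, fun W' hW' A B hAB => ?_⟩
    obtain ⟨x, hx, rfl⟩ := Finset.mem_image.1 hW'
    by_contra! hne
    obtain ⟨⟨y, hyK, hy⟩, ⟨z, hzK, hz⟩⟩ := hne
    rw [hW x (htV x hx) ⟨hyK, hy.1⟩ ⟨hzK, hz.1⟩] at hy
    exact disjoint_left.1 hAB hy.2 hz.2
  · rintro ⟨F, hVF, hF⟩
    refine eq_empty_of_forall_notMem fun x ⟨hxK, hxV⟩ => ?_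
    obtain ⟨W, hWF, hxW⟩ := mem_iUnion₂.1 (hVF hxV)
    refine notMem_iteratedDerivedSet_succ (W.isClopen.isOpen.mem_nhds hxW)
      (fun y hyW hyx hyK => ?_) hxK
    obtain ⟨A, hA, hxA, hyA⟩ := exists_isClopen_of_totally_separated hyx.symm
    have hxK' := iteratedDerivedSet_antitone K (lt_add_one γ).le hxK
    rcases hF W hWF ⟨A, hA⟩ ⟨Aᶜ, hA.compl⟩ disjoint_compl_right with h | h
    · exact eq_empty_iff_forall_notMem.1 h x ⟨hxK', hxW, hxA⟩
    · exact eq_empty_iff_forall_notMem.1 h y ⟨hyK, hyW, hyA⟩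

theorem iteratedDerivedSet_limit_inter_eq_empty_iff {K : Set (ℕ → Bool)} (hK : IsClosed K)
    {γ : Ordinal.{0}} (hγ : Order.IsSuccLimit γ) (V : Clopens (ℕ → Bool)) :
    iteratedDerivedSet K γ ∩ V = ∅ ↔ ∃ δ : Iio γ, iteratedDerivedSet K δ ∩ V = ∅ := by
  constructor
  · intro h
    by_contra! hne
    have : Nonempty (Iio γ) := ⟨⟨0, hγ.bot_lt⟩⟩
    have hclosed : ∀ δ : Iio γ, IsClosed (iteratedDerivedSet K δ ∩ V) := fun δ =>
      (isClosed_iteratedDerivedSet hK δ).inter V.isClopen.isClosed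
    obtain ⟨x, hx⟩ := IsCompact.nonempty_iInter_of_directed_nonempty_isCompact_isClosed
      (fun δ : Iio γ => iteratedDerivedSet K δ ∩ V)
      (directed_of_isDirected_le fun δ ε hle =>
        inter_subset_inter_left _ (iteratedDerivedSet_antitone K hle))
      hne (fun δ => (hclosed δ).isCompact) hclosed
    rw [← iInter_inter, ← iteratedDerivedSet_limit hγ, h] at hx
    exact hx
  · rintro ⟨δ, hδ⟩
    exact subset_empty_iff.1 (hδ ▸ inter_subset_inter_left _
      (iteratedDerivedSet_antitone K (le_of_lt δ.2)))

attribute [local instance] borel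

/-- For countable `γ` the map sending a compact set to its derivative of order `γ` is Borel. It is
enough to consider clopen test sets. -/
theorem measurableSet_iteratedDerivedSet_inter_eq_empty {γ : Ordinal.{0}}
    (hγ : (Iio γ).Countable) (V : Clopens (ℕ → Bool)) :
    MeasurableSet {K : Compacts (ℕ → Bool) |
      iteratedDerivedSet (K : Set (ℕ → Bool)) γ ∩ V = ∅} := by
  have : BorelSpace (Compacts (ℕ → Bool)) := ⟨rfl⟩
  have := countable_clopens_cantor
  induction γ using Ordinal.limitRecOn generalizing V with
  | zero =>
    have h := Compacts.isClosed_subsets_of_isClosed V.isClopen.compl.isClosed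
    convert h.measurableSet using 1
    ext K
    simp only [mem_ofPred_eq, iteratedDerivedSet_zero, ← disjoint_iff_inter_eq_empty,
      subset_compl_iff_disjoint_right]
  | add_one γ ih =>
    have hγ' := hγ.mono (Iio_subset_Iio (lt_add_one γ).le)
    simp only [fun K : Compacts (ℕ → Bool) =>
      iteratedDerivedSet_succ_inter_eq_empty_iff (γ := γ) K.isCompact.isClosed V]
    refine measurableSet_setOfPred.2 (.exists fun F => measurable_const.and (.forall fun W =>
      .forall fun _ => .forall fun A => .forall fun B => .forall fun _ => .or ?_ ?_))
    · exact measurableSet_setOfPred.1 (ih hγ' _)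
    · exact measurableSet_setOfPred.1 (ih hγ' _)
  | limit γ hlim ih =>
    have := hγ.to_subtype
    simp only [fun K : Compacts (ℕ → Bool) =>
      iteratedDerivedSet_limit_inter_eq_empty_iff K.isCompact.isClosed hlim V]
    exact measurableSet_setOfPred.2 (.exists fun δ => measurableSet_setOfPred.1
      (ih δ δ.2 (hγ.mono (Iio_subset_Iio (le_of_lt δ.2))) V))

theorem analyticSet_range_derivativeCode (hα : Order.IsSuccLimit α) (hc : (Iio α).Countable) :
    MeasureTheory.AnalyticSet (range fun K : compactsCBLT α => derivativeCode α K) := by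
  have : BorelSpace (Compacts (ℕ → Bool)) := ⟨rfl⟩
  have := hc.to_subtype
  have := countable_clopens_cantor
  have : PolishSpace (Compacts (ℕ → Bool)) := by
    let _ := metrizableSpaceMetric (Compacts (ℕ → Bool))
    infer_instance
  have hmeas : MeasurableSet (compactsCBLT α) := by
    have heq : compactsCBLT α = ⋃ γ : Iio α, {K : Compacts (ℕ → Bool) |
        iteratedDerivedSet (K : Set (ℕ → Bool)) γ ∩ (⊤ : Clopens (ℕ → Bool)) = ∅} := by
      ext K
      simp [mem_compactsCBLT_of_isSuccLimit hα]
    rw [heq]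
    exact MeasurableSet.iUnion fun γ => measurableSet_iteratedDerivedSet_inter_eq_empty
      (hc.mono (Iio_subset_Iio (le_of_lt γ.2))) _
  have hcode : Measurable (derivativeCode α) := by
    refine measurable_id.prodMk (measurable_pi_iff.2 fun p => measurable_to_bool ?_)
    convert measurableSet_iteratedDerivedSet_inter_eq_empty
      (hc.mono (Iio_subset_Iio (le_of_lt p.2.2))) p.1 using 1
    ext K
    simp
  have := hmeas.analyticSet_image hcode
  rwa [image_eq_range] at this

theorem isOfType_compactsCBLT (hα : Order.IsSuccLimit α) (hc : (Iio α).Countable) :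
    IsOfType (compactsCBLT α) (ℕ → ℕ) (RelCalibre ℵ₀) := by
  let _ := fineTopology α
  have := hc.to_subtype
  have := countable_clopens_cantor
  exact IsCSB.isOfType (isCSB_fineTopology hα) ⟨rfl⟩ (analyticSet_range_derivativeCode hα hc)

theorem powerfullyCalibre_compactsCBLT (hα : Order.IsSuccLimit α) (hc : (Iio α).Countable) :
    PowerfullyCalibre (compactsCBLT α) :=
  @IsCSB.powerfullyCalibre _ _ (fineTopology α) (secondCountableTopology_fineTopology hc)
    (isCSB_fineTopology hα)

end Fine

/-! ### Tukey type and calibres of the spaces `compactsCBLT α` -/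

theorem mainTheorem7 (α : Ordinal.{0}) (hα₀ : 0 < α) (hα : α.card ≤ ℵ₀) :
    ((∃ β : Ordinal.{0}, α = β + 1) →
      TukeyEquiv (compactsCBLT α) (Finset (Cardinal.continuum.{0}).ord.ToType)) ∧
    (Order.IsSuccLimit α →
      -- (a)
      (SecondCountableTopology (compactsCBLT α) ∧
        ¬ IsCSBS (compactsCBLT α) ∧
        ¬ Calibre₃ ℵ₁ ℵ₁ ℵ₀ (compactsCBLT α) ∧
        ∀ (M : Type u) [TopologicalSpace M] [MetrizableSpace M] [SeparableSpace M],
          ¬ TukeyGE (Compacts M) (compactsCBLT α)) ∧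
      -- (b)
      (∃ σ : TopologicalSpace (compactsCBLT α),
        σ ≤ instTopologicalSpaceSubtype ∧
        @SecondCountableTopology (compactsCBLT α) σ ∧ @IsCSB (compactsCBLT α) _ σ) ∧
      -- (c)
      IsOfType (compactsCBLT α) (ℕ → ℕ) (RelCalibre ℵ₀) ∧
      -- (d)
      PowerfullyCalibre (compactsCBLT α) ∧
      -- (e)
      (ℵ₁ < boundingNumber →
        Calibre₄ ℵ₁ ℵ₁ ℵ₀ ℵ₀ (compactsCBLT α) ∧
        ProductivelyCalibre.{0, v} (compactsCBLT α))) := by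
  have hc : (Iio α).Countable := by
    rwa [← le_aleph0_iff_set_countable, mk_Iio_ordinal, lift_le_aleph0]
  refine ⟨?_, fun hlim => ?_⟩
  · rintro ⟨β, rfl⟩
    exact tukeyEquiv_compactsCBLT_add_one (hc.mono (Iio_subset_Iio (lt_add_one β).le))
  have htype := isOfType_compactsCBLT hlim hc
  exact ⟨⟨inferInstance, not_isCSBS_compactsCBLT hlim hc, not_calibre₃_compactsCBLT hα₀,
      fun M _ _ _ => not_tukeyGE_compacts hα₀ hc M⟩,
    ⟨fineTopology α, fineTopology_le, secondCountableTopology_fineTopology hc,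
      isCSB_fineTopology hlim⟩,
    htype, powerfullyCalibre_compactsCBLT hlim hc,
    fun hb => ⟨htype.calibre₄ hb, htype.productivelyCalibre hb⟩⟩
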